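/- Let $n$ be a positive integer and let $J\subseteq\mathbb{Z}_{2n+1}\setminus\{0\}$ satisfy $|J|=n$ and $|\{j,-j\}\cap J|=1$ for every $j\in J$. Let $\overrightarrow{C}_{2n+1}(J)$ be the circulant tournament with vertex set $\mathbb{Z}_{2n+1}$ and arc set $\{(i,j): j-i\in J\}$. If $J$ is neither an arithmetic progression nor a quasi-periodic set, then $\overrightarrow{C}_{2n+1}(J)$ is $\overrightarrow{\omega}_3$-keen. Here a nonempty set $A\subseteq\mathbb{Z}_m$ is an arithmetic progression if $A=\{a+id: 0\le i\le |A|-1\}$ for some $a,d\in\mathbb{Z}_m$ with $d\ne 0$. A nonempty subset $C$ of an abelian group $G$ is quasi-periodic if there are a subgroup $H$ of $G$ with $\{0\}\ne H\ne G$ and a decomposition $C=C'\cup C''$ with $C'\cap C''=\varnothing$ (where $C'$ or $C''$ may be empty) such that $C'+H=C'$ and $C''$ is properly contained in a coset of $H$. For a finite digraph $D$, $\overrightarrow{\omega}_3(D)$ is the maximum number of connected components of the underlying graph of $D\setminus A(D^*)$ over all subdigraphs $D^*$ of $D$ that contain no directed triangle $\overrightarrow{C}_3$. A partition $\pi$ of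 $V(D)$ into nonempty classes is externally $\overrightarrow{C}_3$-free if the arcs of $D$ joining different classes of $\pi$ form a digraph without $\overrightarrow{C}_3$; it is optimal if moreover it has exactly $\overrightarrow{\omega}_3(D)$ classes. A class is singular if it has exactly one element. $D$ is $\overrightarrow{\omega}_3$-keen if some optimal externally $\overrightarrow{C}_3$-free partition of $V(D)$ has exactly one singular class and no externally $\overrightarrow{C}_3$-free partition of $V(D)$ has more than one singular class. -/

import Mathlib

open scoped Pointwise

/-- A digraph is directed-triangle-free if it has no directed cycle of length three
(on three distinct vertices). -/
def Digraph.IsC3Free {V : Type*} (D : Digraph V) : Prop :=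
  ∀ u v w : V, u ≠ v → v ≠ w → w ≠ u → ¬ (D.Adj u v ∧ D.Adj v w ∧ D.Adj w u)

/-- The directed triangle-free disconnection: the maximum number of connected components of the
underlying graph of `D` minus the arcs of `D'`, over all directed-triangle-free subdigraphs `D'`
of `D`. (Only the arc set of `D'` matters, so spanning subdigraphs suffice. On a finite vertex set
the supremum is that of a nonempty bounded set of naturals, hence a maximum.) -/
noncomputable def Digraph.omega3 {V : Type*} (D : Digraph V) : ℕ :=
  sSup {k : ℕ | ∃ D' : Digraph V, D' ≤ D ∧ D'.IsC3Free ∧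
    k = Nat.card (D \ D').toSimpleGraphInclusive.ConnectedComponent}

section Partitions

variable {V : Type*} [Fintype V] [DecidableEq V]

/-- The subdigraph of `D` formed by the arcs that are external for the partition `π`, that is,
whose end points lie in different classes. -/
def Digraph.externalArcs (D : Digraph V) (π : Finpartition (Finset.univ : Finset V)) :
    Digraph V where
  Adj u v := D.Adj u v ∧ π.part u ≠ π.part v

/-- `π` is an externally directed-triangle-free partition of the vertex set of `D`. -/
def Digraph.IsExternallyC3Free (D : Digraph V)
    (π : Finpartition (Finset.univ : Finset V)) : Prop :=
  (D.externalArcs π).IsC3Free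

/-- An externally directed-triangle-free partition is optimal if its number of classes is the
directed triangle-free disconnection of `D`. -/
def Digraph.IsOptimalExternallyC3Free (D : Digraph V)
    (π : Finpartition (Finset.univ : Finset V)) : Prop :=
  D.IsExternallyC3Free π ∧ π.parts.card = D.omega3

/-- The number of singular classes (classes with exactly one element) of a partition. -/
def numSingularClasses (π : Finpartition (Finset.univ : Finset V)) : ℕ :=
  (π.parts.filter (fun C => C.card = 1)).card

/-- `D` is keen for the directed triangle-free disconnection: some optimal externally
directed-triangle-free partition has exactly one singular class, and no externally
directed-triangle-free partition has more than one. -/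
def Digraph.IsOmega3Keen (D : Digraph V) : Prop :=
  (∃ π : Finpartition (Finset.univ : Finset V),
    D.IsOptimalExternallyC3Free π ∧ numSingularClasses π = 1) ∧
  ∀ π : Finpartition (Finset.univ : Finset V),
    D.IsExternallyC3Free π → numSingularClasses π ≤ 1

end Partitions

/-- `J` is the symbol set of a circulant tournament of order `2 * n + 1`. -/
def IsSymbolSet (n : ℕ) (J : Finset (ZMod (2 * n + 1))) : Prop :=
  0 ∉ J ∧ J.card = n ∧ ∀ j ∈ J, (({j, -j} : Finset (ZMod (2 * n + 1))) ∩ J).card = 1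

/-- The circulant digraph on the integers modulo `m` with symbol set `J`;
a circulant tournament when `m = 2 * n + 1` and `J` is a symbol set. -/
def circulantTournament {m : ℕ} (J : Finset (ZMod m)) : Digraph (ZMod m) where
  Adj i j := j - i ∈ J

/-- `A` is a nonempty arithmetic progression with nonzero difference:
`A = {a + i d : 0 ≤ i ≤ |A| - 1}`. -/
def IsArithProg {m : ℕ} (A : Finset (ZMod m)) : Prop :=
  A.Nonempty ∧ ∃ a d : ZMod m, d ≠ 0 ∧
    (A : Set (ZMod m)) = {x | ∃ i : ℕ, i < A.card ∧ x = a + (i : ZMod m) * d}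

/-- `C` is quasi-periodic: for some nontrivial (nonzero and proper) subgroup `H`, `C` is the
disjoint union of a (possibly empty) union `C'` of `H`-cosets and a (possibly empty) set `C''`
that is properly contained in a single `H`-coset. -/
def IsQuasiPeriodic {G : Type*} [AddCommGroup G] (C : Set G) : Prop :=
  C.Nonempty ∧ ∃ H : AddSubgroup G, H ≠ ⊥ ∧ H ≠ ⊤ ∧ ∃ C' C'' : Set G,
    C = C' ∪ C'' ∧ Disjoint C' C'' ∧
    C' + (H : Set G) = C' ∧ ∃ c : G, C'' ⊂ c +ᵥ (H : Set G)

section SmallSumsets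

/-! ### Sumsets with Sidon sets -/

variable {G : Type*} [AddCommGroup G] [DecidableEq G]

/-- Distinct translates of `A` meet in at most one element. -/
def IsSidonSet (A : Finset G) : Prop :=
  ∀ x : G, x ≠ 0 → (A ∩ (x +ᵥ A)).card ≤ 1

theorem IsSidonSet.card_add_pair {A : Finset G} (hA : IsSidonSet A) {x y : G} (hxy : x ≠ y) :
    2 * A.card ≤ ((x +ᵥ A) ∪ (y +ᵥ A)).card + 1 := by
  have h := Finset.card_union_add_card_inter (x +ᵥ A) (y +ᵥ A)
  have hi : ((x +ᵥ A) ∩ (y +ᵥ A)).card ≤ 1 := by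
    have : (x +ᵥ A) ∩ (y +ᵥ A) = x +ᵥ (A ∩ ((y - x) +ᵥ A)) := by
      rw [Finset.vadd_finset_inter, vadd_vadd]
      simp
    rw [this, Finset.card_vadd_finset]
    exact hA _ (sub_ne_zero.2 hxy.symm)
  rw [Finset.card_vadd_finset, Finset.card_vadd_finset] at h
  omega

theorem vadd_subset_add {A T : Finset G} {x : G} (hx : x ∈ T) : x +ᵥ A ⊆ T + A := by
  intro z hz
  obtain ⟨a, ha, rfl⟩ := Finset.mem_vadd_finset.1 hz
  exact Finset.add_mem_add hx ha

theorem IsSidonSet.two_mul_card_le {A T : Finset G} (hA : IsSidonSet A) (hT : 2 ≤ T.card) :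
    2 * A.card ≤ (T + A).card + 1 := by
  obtain ⟨x, hx, y, hy, hxy⟩ := Finset.one_lt_card.1 hT
  refine (hA.card_add_pair hxy).trans ?_
  gcongr
  exact Finset.union_subset (vadd_subset_add hx) (vadd_subset_add hy)

theorem IsSidonSet.three_mul_card_le {A T : Finset G} (hA : IsSidonSet A) (hT : 3 ≤ T.card) :
    3 * A.card ≤ (T + A).card + 3 := by
  obtain ⟨x, hx, y, hy, z, hz, hxy, hxz, hyz⟩ := Finset.two_lt_card.1 hT
  have hinter : ∀ u v : G, u ≠ v → ((u +ᵥ A) ∩ (v +ᵥ A)).card ≤ 1 := fun u v huv => by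
    have h := Finset.card_union_add_card_inter (u +ᵥ A) (v +ᵥ A)
    have h' := hA.card_add_pair huv
    rw [Finset.card_vadd_finset, Finset.card_vadd_finset] at h
    omega
  have h1 := hA.card_add_pair hxy
  have h2 := Finset.card_union_add_card_inter ((x +ᵥ A) ∪ (y +ᵥ A)) (z +ᵥ A)
  have h3 : (((x +ᵥ A) ∪ (y +ᵥ A)) ∩ (z +ᵥ A)).card ≤ 2 := by
    rw [Finset.union_inter_distrib_right]
    refine (Finset.card_union_le _ _).trans ?_
    have := hinter x z hxz
    have := hinter y z hyz
    omega
  have h4 : (((x +ᵥ A) ∪ (y +ᵥ A)) ∪ (z +ᵥ A)).card ≤ (T + A).card :=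
    Finset.card_le_card (Finset.union_subset (Finset.union_subset (vadd_subset_add hx)
      (vadd_subset_add hy)) (vadd_subset_add hz))
  rw [Finset.card_vadd_finset] at h2
  omega

/-- Since `0 ∈ A`, no growth means `S + A = S`; every element of `A` then stabilizes `S`, and so
does the subgroup they generate. -/
theorem add_mem_of_card_add_le {A S : Finset G} (h0 : 0 ∈ A) (h : (S + A).card ≤ S.card)
    {k s : G} (hk : k ∈ AddSubgroup.closure (A : Set G)) (hs : s ∈ S) : k + s ∈ S := by
  have hSA : S = S + A :=
    Finset.eq_of_subset_of_card_le (fun z hz => by simpa using Finset.add_mem_add hz h0) h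
  have hle : AddSubgroup.closure (A : Set G) ≤ AddAction.stabilizer G S := by
    rw [AddSubgroup.closure_le]
    intro a ha
    change a +ᵥ S = S
    refine Finset.eq_of_subset_of_card_le (fun z hz => ?_) (Finset.card_vadd_finset _ _).ge
    obtain ⟨t, ht, rfl⟩ := Finset.mem_vadd_finset.1 hz
    have := Finset.add_mem_add ht ha
    rwa [← hSA, add_comm] at this
  have hkS : k +ᵥ S = S := hle hk
  rw [← hkS]
  exact Finset.vadd_mem_vadd_finset hs

/-! ### 2-atoms and the isoperimetric method -/

variable [Fintype G]

/-- `X` separates two points by translates of `S`: it has at least two elements and the sumset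
`X + S` misses at least two elements. -/
def IsTwoSeparating (S X : Finset G) : Prop :=
  2 ≤ X.card ∧ (X + S).card + 2 ≤ Fintype.card G

/-- A `2`-atom of `S`: a `2`-separating set that minimizes `|X + S| - |X|` and, among the
minimizers, has the least cardinality. -/
structure IsTwoAtom (S A : Finset G) : Prop where
  sep : IsTwoSeparating S A
  le : ∀ X, IsTwoSeparating S X → (A + S).card + X.card ≤ (X + S).card + A.card
  card_le : ∀ X, IsTwoSeparating S X → (A + S).card + X.card = (X + S).card + A.card →
    A.card ≤ X.card

theorem IsTwoSeparating.exists_isTwoAtom {S X : Finset G} (hX : IsTwoSeparating S X) :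
    ∃ A, IsTwoAtom S A := by
  classical
  obtain ⟨A, hA, hmin⟩ := Finset.exists_min_image
    (Finset.univ.filter (fun X : Finset G => IsTwoSeparating S X))
    (fun X => ((X + S).card : ℤ) - X.card) ⟨X, by simpa using hX⟩
  obtain ⟨B, hB, hBmin⟩ := Finset.exists_min_image
    (Finset.univ.filter (fun X : Finset G => IsTwoSeparating S X ∧
      ((X + S).card : ℤ) - X.card = (A + S).card - A.card))
    Finset.card ⟨A, by simpa using hA⟩
  simp only [Finset.mem_filter, Finset.mem_univ, true_and] at hA hmin hB hBmin
  refine ⟨B, hB.1, fun Y hY => ?_, fun Y hY hYe => hBmin Y ⟨hY, ?_⟩⟩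
  · have := hmin Y hY
    omega
  · omega

/-- Duality: `Y = -(A + S)ᶜ` is again separating, and `Y + S` avoids `-A`, so `Y` is also a
minimizer. The least cardinality of the atom gives `|A| ≤ |Y|`. -/
theorem IsTwoAtom.card_add_card_le {S A : Finset G} (hA : IsTwoAtom S A) :
    (A + S).card + A.card ≤ Fintype.card G := by
  have h1 := hA.sep.1
  have h2 := hA.sep.2
  set Y : Finset G := -(A + S)ᶜ with hY
  have hYc : Y.card + (A + S).card = Fintype.card G := by
    rw [hY, Finset.card_neg, add_comm, Finset.card_add_card_compl]
  have hdis : Disjoint (Y + S) (-A) := by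
    rw [Finset.disjoint_left]
    intro z hz hzA
    obtain ⟨y, hy, s, hs, rfl⟩ := Finset.mem_add.1 hz
    rw [hY, Finset.mem_neg'] at hy
    rw [Finset.mem_neg'] at hzA
    refine (Finset.mem_compl.1 hy) (Finset.mem_add.2 ⟨_, hzA, s, hs, by abel⟩)
  have hle : (Y + S).card + A.card ≤ Fintype.card G := by
    rw [← Finset.card_neg (s := A), ← Finset.card_union_of_disjoint hdis]
    exact Finset.card_le_univ _
  have hsep : IsTwoSeparating S Y := ⟨by omega, by omega⟩
  have h3 := hA.le Y hsep
  have h4 := hA.card_le Y hsep (by omega)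
  omega

/-- Submodularity of `|X + S| - |X|`: an intersection of two or more elements, smaller than the
atom, has value strictly above the minimum, so the union lies strictly below it. The duality bound
keeps the union separating, a contradiction. -/
theorem IsTwoAtom.vadd_eq_or_card_inter_le {S A : Finset G} (hA : IsTwoAtom S A) (x : G) :
    x +ᵥ A = A ∨ (A ∩ (x +ᵥ A)).card ≤ 1 := by
  by_contra! hcon
  obtain ⟨hne, hI⟩ := hcon
  have h1 := hA.sep.1
  have h2 := hA.sep.2
  have hdual := hA.card_add_card_le
  set B := x +ᵥ A with hB
  have hBc : B.card = A.card := Finset.card_vadd_finset _ _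
  have hBS : (B + S).card = (A + S).card := by
    rw [hB, vadd_add_assoc, Finset.card_vadd_finset]
  have hui := Finset.card_union_add_card_inter A B
  have hui' := Finset.card_union_add_card_inter (A + S) (B + S)
  rw [← Finset.union_add] at hui'
  have hsub : (A ∩ B + S).card ≤ ((A + S) ∩ (B + S)).card :=
    Finset.card_le_card Finset.inter_add_subset
  have hIA : (A ∩ B + S).card ≤ (A + S).card :=
    Finset.card_le_card (Finset.add_subset_add_right Finset.inter_subset_left)
  have hIlt : (A ∩ B).card < A.card := by
    refine Finset.card_lt_card (Finset.ssubset_iff_subset_ne.2 ⟨Finset.inter_subset_left, ?_⟩)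
    intro h
    exact hne (Finset.eq_of_subset_of_card_le (Finset.inter_eq_left.1 h) hBc.le).symm
  have hsepI : IsTwoSeparating S (A ∩ B) := ⟨by omega, by omega⟩
  have h3 := hA.le _ hsepI
  have h4 := hA.card_le _ hsepI
  have hsepU : IsTwoSeparating S (A ∪ B) := ⟨by omega, by omega⟩
  have h5 := hA.le _ hsepU
  omega

theorem IsTwoAtom.isSidonSet_or_coset {S A : Finset G} (hA : IsTwoAtom S A) :
    IsSidonSet A ∨ ∃ (H : AddSubgroup G) (a : G), H ≠ ⊥ ∧
      ∀ z, z ∈ A ↔ z - a ∈ H := by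
  by_cases hS : IsSidonSet A
  · exact Or.inl hS
  right
  unfold IsSidonSet at hS
  push Not at hS
  obtain ⟨x, hx0, hx⟩ := hS
  have hxA : x +ᵥ A = A := (hA.vadd_eq_or_card_inter_le x).resolve_right (by omega)
  have hAne : A.Nonempty := Finset.card_pos.1 (by have := hA.sep.1; omega)
  obtain ⟨a, ha⟩ := hAne
  have hadd : ∀ z ∈ A, x + z ∈ A := fun z hz => by
    rw [← hxA]; exact Finset.vadd_mem_vadd_finset hz
  refine ⟨AddAction.stabilizer G A, a, ?_, fun z => ⟨fun hz => ?_, fun hz => ?_⟩⟩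
  · intro h
    apply hx0
    rw [← AddSubgroup.mem_bot, ← h]
    exact hxA
  -- By periodicity under `x`, the translate of `A` by `z - a` shares both `z` and `x + z` with `A`,
  -- so it is `A` itself.
  · refine (hA.vadd_eq_or_card_inter_le (z - a)).resolve_right ?_
    rw [not_le, Finset.one_lt_card]
    refine ⟨z, ?_, x + z, ?_, ?_⟩
    · refine Finset.mem_inter.2 ⟨hz, Finset.mem_vadd_finset.2 ⟨a, ha, by simp⟩⟩
    · refine Finset.mem_inter.2 ⟨hadd z hz, Finset.mem_vadd_finset.2 ⟨x + a, hadd a ha, ?_⟩⟩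
      rw [vadd_eq_add]; abel
    · simpa using hx0
  · have : (z - a) +ᵥ A = A := hz
    rw [← this]
    exact Finset.mem_vadd_finset.2 ⟨a, ha, by simp⟩

/-- Passing to a `2`-atom `M` of the Sidon set `A` itself: a counterexample forces `|M + A| < |M| +
|A|`. If `M` is Sidon, three translates of each set inside `M + A` are already too many. If `M` is a
coset, then `|A| ≤ |M|` leaves no room for a second coset, so `A` lies in the subgroup, which must
be everything. -/
theorem IsSidonSet.card_add_card_le_of_sep {A T : Finset G} (hA : IsSidonSet A) (h0 : 0 ∈ A)
    (hgen : AddSubgroup.closure (A : Set G) = ⊤) (h3 : 3 ≤ A.card) (hT : IsTwoSeparating A T) :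
    T.card + A.card ≤ (T + A).card := by
  by_contra! hlt
  obtain ⟨M, hM⟩ := hT.exists_isTwoAtom
  have h1 := hM.le T hT
  have h2 := hM.sep.1
  have hMm := hM.sep.2
  have hpair := hA.two_mul_card_le h2
  have hM3 : 3 ≤ M.card := by
    by_contra! h
    omega
  rcases hM.isSidonSet_or_coset with hS | ⟨H, m, hH, hmem⟩
  · have h4 := hA.three_mul_card_le hM3
    have h5 := hS.three_mul_card_le h3
    rw [add_comm A M] at h5
    omega
  · have hle : A.card ≤ M.card := by omega
    have hMA : M + A = M := by
      classical
      by_contra hne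
      obtain ⟨z, hz, hzM⟩ : ∃ z ∈ M + A, z ∉ M := by
        by_contra! hall
        refine hne (Finset.Subset.antisymm hall fun z hz => ?_)
        simpa using Finset.add_mem_add hz h0
      have hsub : M ∪ ((z - m) +ᵥ M) ⊆ M + A := by
        obtain ⟨p, hp, a, ha, rfl⟩ := Finset.mem_add.1 hz
        refine Finset.union_subset (fun z hz => by simpa using Finset.add_mem_add hz h0) ?_
        intro w hw
        obtain ⟨q, hq, rfl⟩ := Finset.mem_vadd_finset.1 hw
        refine Finset.mem_add.2 ⟨p + q - m, ?_, a, ha, ?_⟩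
        · rw [hmem] at hp hq ⊢
          convert H.add_mem hp hq using 1
          abel
        · rw [vadd_eq_add]; abel
      have hdis : Disjoint M ((z - m) +ᵥ M) := by
        rw [Finset.disjoint_left]
        intro w hw hw'
        obtain ⟨q, hq, rfl⟩ := Finset.mem_vadd_finset.1 hw'
        apply hzM
        rw [hmem] at hw hq ⊢
        convert H.sub_mem hw hq using 1
        rw [vadd_eq_add]; abel
      have := Finset.card_le_card hsub
      rw [Finset.card_union_of_disjoint hdis, Finset.card_vadd_finset] at this
      omega
    have hAH : (A : Set G) ⊆ H := by
      intro a ha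
      have hm : m ∈ M := by rw [hmem]; simp
      have : m + a ∈ M := by rw [← hMA]; exact Finset.add_mem_add hm ha
      rw [hmem] at this
      simpa using this
    have hHtop : H = ⊤ := by
      rw [eq_top_iff, ← hgen]
      exact (AddSubgroup.closure_le _).2 hAH
    have : M = Finset.univ := by
      ext z
      simp [hmem, hHtop]
    rw [hMA, this, Finset.card_univ] at hMm
    omega

theorem IsSidonSet.card_add_card_le {A T : Finset G} (hA : IsSidonSet A) (h0 : 0 ∈ A)
    (hgen : AddSubgroup.closure (A : Set G) = ⊤) (h3 : 3 ≤ A.card) (hT : T.Nonempty)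
    (hTA : T + A ≠ Finset.univ) : T.card + A.card ≤ (T + A).card + 1 := by
  by_cases h : IsTwoSeparating A T
  · have := hA.card_add_card_le_of_sep h0 hgen h3 h
    omega
  have hle : A.card ≤ (T + A).card := Finset.card_le_card_add_left hT
  have hpos := hT.card_pos
  unfold IsTwoSeparating at h
  by_cases h2 : T.card = 1
  · omega
  obtain ⟨y, hy⟩ : ∃ y, y ∉ T + A := by
    by_contra! hall
    exact hTA (Finset.eq_univ_of_forall hall)
  -- The remaining case is that `T + A` misses only `y`; then `T` avoids `y - A`, and counting in
  -- `G` suffices.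
  have hdis : Disjoint T (y +ᵥ -A) := by
    rw [Finset.disjoint_left]
    intro t ht ht'
    obtain ⟨a, ha, rfl⟩ := Finset.mem_vadd_finset.1 ht'
    exact hy (Finset.mem_add.2 ⟨_, ht, -a, Finset.mem_neg'.1 ha, by rw [vadd_eq_add]; abel⟩)
  have := Finset.card_le_univ (T ∪ (y +ᵥ -A))
  rw [Finset.card_union_of_disjoint hdis, Finset.card_vadd_finset, Finset.card_neg] at this
  omega

theorem IsSidonSet.card_add_card_le_of_subset_closure {A T : Finset G} (hA : IsSidonSet A)
    (h0 : 0 ∈ A) (h3 : 3 ≤ A.card) (hT : T.Nonempty)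
    (hTK : ∀ t ∈ T, t ∈ AddSubgroup.closure (A : Set G)) {y : G}
    (hy : y ∈ AddSubgroup.closure (A : Set G)) (hyT : y ∉ T + A) :
    T.card + A.card ≤ (T + A).card + 1 := by
  classical
  set K := AddSubgroup.closure (A : Set G) with hK
  have hinj : Function.Injective K.subtype := Subtype.val_injective
  have lift : ∀ B : Finset G, (∀ b ∈ B, b ∈ K) → ∃ B' : Finset K, B'.image K.subtype = B := by
    intro B hB
    refine ⟨Finset.univ.filter (fun z : K => (z : G) ∈ B), ?_⟩
    ext z
    simp only [Finset.mem_image, Finset.mem_filter, Finset.mem_univ, true_and]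
    constructor
    · rintro ⟨w, hw, rfl⟩
      exact hw
    · intro hz
      exact ⟨⟨z, hB z hz⟩, hz, rfl⟩
  obtain ⟨T', rfl⟩ := lift T hTK
  obtain ⟨A', hA'⟩ := lift A (fun a ha => AddSubgroup.subset_closure ha)
  have hmem : ∀ z : K, (z : G) ∈ A ↔ z ∈ A' := fun z => by
    rw [← hA']
    exact hinj.mem_finset_image (s := A') (a := z)
  have hsum : T'.image K.subtype + A = (T' + A').image K.subtype := by
    rw [Finset.image_add, hA']
  have hcA : A.card = A'.card := by rw [← hA', Finset.card_image_of_injective _ hinj]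
  rw [hsum, Finset.card_image_of_injective _ hinj, Finset.card_image_of_injective _ hinj, hcA]
  refine IsSidonSet.card_add_card_le (A := A') ?_ ((hmem 0).1 h0) ?_ (by omega) ?_ ?_
  · intro x hx
    refine le_trans ?_ (hA (x : G) (by simpa using hx))
    refine Finset.card_le_card_of_injOn (K.subtype) ?_ hinj.injOn
    intro z hz
    simp only [Finset.coe_inter, Set.mem_inter_iff, Finset.mem_coe] at hz ⊢
    refine ⟨(hmem z).2 hz.1, ?_⟩
    obtain ⟨w, hw, rfl⟩ := Finset.mem_vadd_finset.1 hz.2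
    exact Finset.mem_vadd_finset.2 ⟨w, (hmem w).2 hw, rfl⟩
  · have : (A' : Set K) = ((↑) : K → G) ⁻¹' (A : Set G) := by
      ext z
      simp [hmem]
    rw [this, hK]
    exact AddSubgroup.closure_closure_coe_preimage
  · simpa using hT
  · intro h
    apply hyT
    rw [hsum, h]
    simpa using hy

/-- If all holes lie in `S + A`, there are at most `|A| - 1` of them. Otherwise the coset of a hole
outside `S + A` already absorbs the whole growth allowed by `hSA`, so the rest of `S` is periodic
and every hole lies in that one coset, which also contains a point of `S`. -/
theorem card_lt_card_closure_of_holes {A S Z : Finset G} (h0 : 0 ∈ A)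
    (hSA : (S + A).card + 1 ≤ S.card + A.card)
    (hgrow : ∀ T : Finset G, T.Nonempty → (∀ t ∈ T, t ∈ AddSubgroup.closure (A : Set G)) →
      0 ∉ T + A → T.card + A.card ≤ (T + A).card + 1)
    (hZ : ∀ z ∈ Z, z ∉ S ∧ ∃ s ∈ S, z - s ∈ AddSubgroup.closure (A : Set G)) :
    Z.card < Nat.card (AddSubgroup.closure (A : Set G)) := by
  classical
  set K := AddSubgroup.closure (A : Set G) with hK
  have hKc : Nat.card K = (Finset.univ.filter (fun z => z ∈ K)).card := by
    rw [Nat.card_eq_fintype_card, Fintype.card_subtype]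
  have hAK : A.card ≤ Nat.card K := by
    rw [hKc]
    refine Finset.card_le_card fun a ha => ?_
    simpa using AddSubgroup.subset_closure ha
  by_cases hall : Z ⊆ S + A
  · have hdis : Disjoint Z S := Finset.disjoint_left.2 fun z hz => (hZ z hz).1
    have := Finset.card_le_card (Finset.union_subset hall
      (fun z hz => by simpa using Finset.add_mem_add hz h0 : S ⊆ S + A))
    rw [Finset.card_union_of_disjoint hdis] at this
    omega
  obtain ⟨y, hyZ, hy⟩ := Finset.not_subset.1 hall
  set Q := S.filter (fun s => s - y ∈ K) with hQ
  set R := S.filter (fun s => s - y ∉ K) with hR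
  have hQne : Q.Nonempty := by
    obtain ⟨s, hs, hsK⟩ := (hZ y hyZ).2
    refine ⟨s, Finset.mem_filter.2 ⟨hs, ?_⟩⟩
    have := K.neg_mem hsK
    rwa [neg_sub] at this
  have hgQ : Q.card + A.card ≤ (Q + A).card + 1 := by
    have h := hgrow (-y +ᵥ Q) (hQne.vadd_finset) ?_ ?_
    · rwa [vadd_add_assoc, Finset.card_vadd_finset, Finset.card_vadd_finset] at h
    · intro t ht
      obtain ⟨s, hs, rfl⟩ := Finset.mem_vadd_finset.1 ht
      have := (Finset.mem_filter.1 hs).2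
      rwa [vadd_eq_add, neg_add_eq_sub]
    · intro h
      rw [vadd_add_assoc, Finset.mem_vadd_finset] at h
      obtain ⟨z, hz, hzy⟩ := h
      rw [vadd_eq_add, neg_add_eq_zero] at hzy
      rw [hzy] at hy
      exact hy (Finset.add_subset_add_right (Finset.filter_subset _ _) hz)
  have hcard : Q.card + R.card = S.card := Finset.card_filter_add_card_filter_not _
  have hdis : Disjoint (Q + A) (R + A) := by
    rw [Finset.disjoint_left]
    intro z hz hz'
    obtain ⟨q, hq, a, ha, rfl⟩ := Finset.mem_add.1 hz
    obtain ⟨r, hr, b, hb, hrb⟩ := Finset.mem_add.1 hz'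
    have hq' := (Finset.mem_filter.1 hq).2
    refine (Finset.mem_filter.1 hr).2 ?_
    have ha' : a ∈ K := AddSubgroup.subset_closure ha
    have hb' : b ∈ K := AddSubgroup.subset_closure hb
    have := K.add_mem hq' (K.sub_mem ha' hb')
    have e : r = q + a - b := eq_sub_of_add_eq hrb
    rw [e]
    convert this using 1
    abel
  have hsum : (Q + A).card + (R + A).card ≤ (S + A).card := by
    rw [← Finset.card_union_of_disjoint hdis]
    exact Finset.card_le_card (Finset.union_subset
      (Finset.add_subset_add_right (Finset.filter_subset _ _))
      (Finset.add_subset_add_right (Finset.filter_subset _ _)))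
  have hRA : (R + A).card ≤ R.card := by omega
  have hsub : Z ∪ Q ⊆ y +ᵥ Finset.univ.filter (fun z => z ∈ K) := by
    intro z hz
    refine Finset.mem_vadd_finset.2 ⟨z - y, ?_, by simp⟩
    rw [Finset.mem_filter]
    refine ⟨Finset.mem_univ _, ?_⟩
    rcases Finset.mem_union.1 hz with hz | hz
    · obtain ⟨hzS, s, hs, hsK⟩ := hZ z hz
      by_cases hsy : s - y ∈ K
      · have := K.add_mem hsK hsy
        rwa [sub_add_sub_cancel] at this
      · exfalso
        have := add_mem_of_card_add_le h0 hRA hsK (Finset.mem_filter.2 ⟨hs, hsy⟩)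
        rw [sub_add_cancel] at this
        exact hzS (Finset.mem_filter.1 this).1
    · exact (Finset.mem_filter.1 hz).2
  have hdZ : Disjoint Z Q :=
    Finset.disjoint_left.2 fun z hz hzQ => (hZ z hz).1 (Finset.mem_filter.1 hzQ).1
  have := Finset.card_le_card hsub
  rw [Finset.card_union_of_disjoint hdZ, Finset.card_vadd_finset, ← hKc] at this
  have := hQne.card_pos
  omega

theorem IsTwoAtom.vadd {S A : Finset G} (hA : IsTwoAtom S A) (x : G) : IsTwoAtom S (x +ᵥ A) := by
  have h1 : (x +ᵥ A).card = A.card := Finset.card_vadd_finset _ _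
  have h2 : ((x +ᵥ A) + S).card = (A + S).card := by rw [vadd_add_assoc, Finset.card_vadd_finset]
  refine ⟨⟨?_, ?_⟩, fun X hX => ?_, fun X hX h => ?_⟩
  · rw [h1]; exact hA.sep.1
  · rw [h2]; exact hA.sep.2
  · rw [h1, h2]; exact hA.le X hX
  · rw [h1]; rw [h1, h2] at h; exact hA.card_le X hX h

/-- Structure of a set `S` with a critical pair: either a cyclic generator almost stabilizes `S`,
or `S` fills its cosets of a nontrivial proper subgroup `H` up to fewer than `|H|` holes. -/
theorem exists_generator_or_subgroup_of_small_sumset {S X : Finset G} (hS : 2 ≤ S.card)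
    (hX : IsTwoSeparating S X) (hXS : (X + S).card + 1 ≤ X.card + S.card) :
    (∃ d : G, AddSubgroup.closure {d} = ⊤ ∧ (S + {0, d}).card ≤ S.card + 1) ∨
    ∃ H : AddSubgroup G, H ≠ ⊥ ∧ H ≠ ⊤ ∧ ∀ Z : Finset G,
      (∀ z ∈ Z, z ∉ S ∧ ∃ s ∈ S, z - s ∈ H) → Z.card < Nat.card H := by
  classical
  obtain ⟨A, hA0, hA⟩ : ∃ A, 0 ∈ A ∧ IsTwoAtom S A := by
    obtain ⟨A, hA⟩ := hX.exists_isTwoAtom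
    obtain ⟨a, ha⟩ : A.Nonempty := Finset.card_pos.1 (by have := hA.sep.1; omega)
    exact ⟨-a +ᵥ A, Finset.mem_vadd_finset.2 ⟨a, ha, by simp⟩, hA.vadd _⟩
  have hA2 := hA.sep.1
  have hAm := hA.sep.2
  have hSA : (S + A).card + 1 ≤ S.card + A.card := by
    have := hA.le X hX
    rw [add_comm S A]
    omega
  have hbot : AddSubgroup.closure (A : Set G) ≠ ⊥ := by
    intro h
    obtain ⟨a, ha, b, hb, hab⟩ := Finset.one_lt_card.1 hA2
    have h' := fun x (hx : x ∈ A) => AddSubgroup.subset_closure (k := (A : Set G)) hx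
    rw [h] at h'
    exact hab (((AddSubgroup.mem_bot).1 (h' a ha)).trans ((AddSubgroup.mem_bot).1 (h' b hb)).symm)
  by_cases h2 : A.card = 2
  · obtain ⟨d, hd0, rfl⟩ : ∃ d, d ≠ 0 ∧ A = {0, d} := by
      obtain ⟨x, y, hxy, rfl⟩ := Finset.card_eq_two.1 h2
      rcases Finset.mem_insert.1 hA0 with h | h
      · exact ⟨y, by rintro rfl; exact hxy h.symm, by rw [h]⟩
      · rw [Finset.mem_singleton] at h
        exact ⟨x, by rintro rfl; exact hxy h, by rw [h, Finset.pair_comm]⟩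
    have hcl : AddSubgroup.closure (({0, d} : Finset G) : Set G) = AddSubgroup.closure {d} := by
      simp
    by_cases htop : AddSubgroup.closure {d} = (⊤ : AddSubgroup G)
    · exact Or.inl ⟨d, htop, by omega⟩
    refine Or.inr ⟨_, hbot, by rwa [hcl], fun Z hZ =>
      card_lt_card_closure_of_holes hA0 hSA ?_ hZ⟩
    -- For a pair, the growth bound fails only if `T` does not grow; `T` is then stable under the
    -- subgroup and contains `0`.
    rintro T ⟨t, ht⟩ hTK hT0
    by_contra! hlt
    have h := add_mem_of_card_add_le hA0 (by omega : (T + {0, d}).card ≤ T.card)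
      (AddSubgroup.neg_mem _ (hTK t ht)) ht
    rw [neg_add_cancel] at h
    exact hT0 (by simpa using Finset.add_mem_add h hA0)
  · have h3 : 3 ≤ A.card := by omega
    right
    rcases hA.isSidonSet_or_coset with hSid | ⟨H, a, hH, hmem⟩
    · refine ⟨AddSubgroup.closure (A : Set G), hbot, fun htop => ?_, fun Z hZ =>
        card_lt_card_closure_of_holes hA0 hSA (fun T hT hTK hT0 =>
          hSid.card_add_card_le_of_subset_closure hA0 h3 hT hTK (zero_mem _) hT0) hZ⟩
      have := hSid.card_add_card_le_of_sep hA0 htop h3 (T := S) ⟨hS, by rwa [add_comm S A]⟩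
      omega
    · have hmem' : ∀ z, z ∈ A ↔ z ∈ H := by
        have h0 := (hmem 0).1 hA0
        intro z
        rw [hmem, sub_eq_add_neg, ← zero_sub, H.add_mem_cancel_right h0]
      have hAH : (A : Set G) = H := by ext z; exact hmem' z
      have hcl : AddSubgroup.closure (A : Set G) = H := by rw [hAH, AddSubgroup.closure_eq]
      refine ⟨H, hH, fun htop => ?_, fun Z hZ => ?_⟩
      · have : A = Finset.univ := by ext z; simp [hmem', htop]
        have hle : A.card ≤ (A + S).card :=
          Finset.card_le_card_add_right (Finset.card_pos.1 (by omega))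
        rw [this, Finset.card_univ] at hle
        rw [this] at hAm
        omega
      · rw [← hcl] at hZ ⊢
        refine card_lt_card_closure_of_holes hA0 hSA ?_ hZ
        -- Here `A = H`, so `T + A` always contains `0` and the growth condition is vacuous.
        rintro T ⟨t, ht⟩ hTK hT0
        exfalso
        refine hT0 (Finset.mem_add.2 ⟨t, ht, -t, ?_, by simp⟩)
        rw [hmem', ← hcl]
        exact neg_mem (hTK t ht)

end SmallSumsets

/-! ### From small sumsets to the structure of symbol sets -/

section SymbolSets

/-- Steps by `d` run through the whole group in one cycle, and each maximal run of `J` on it ends at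
a point `x` with `x + d ∉ J`. A single such end means a single run. -/
theorem isArithProg_of_almost_stable {m : ℕ} [NeZero m] {J : Finset (ZMod m)} (hJ : J.Nonempty)
    (hJu : J ≠ Finset.univ) {d : ZMod m} (hd : AddSubgroup.closure {d} = ⊤)
    (hone : ∀ x ∈ J, ∀ y ∈ J, x + d ∉ J → y + d ∉ J → x = y) : IsArithProg J := by
  classical
  have hstable : ∀ T : Finset (ZMod m), T.Nonempty → (∀ t ∈ T, t + d ∈ T) → T = Finset.univ := by
    rintro T ⟨t, ht⟩ hT
    refine Finset.eq_univ_of_forall fun z => ?_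
    have hcard : (T + {0, d}).card ≤ T.card := by
      refine Finset.card_le_card fun w hw => ?_
      obtain ⟨s, hs, e, he, rfl⟩ := Finset.mem_add.1 hw
      simp only [Finset.mem_insert, Finset.mem_singleton] at he
      rcases he with rfl | rfl
      · simpa using hs
      · exact hT s hs
    have := add_mem_of_card_add_le (k := z - t) (by simp) hcard (by simp [hd]) ht
    simpa using this
  obtain ⟨a, ha, had⟩ : ∃ a ∈ J, a - d ∉ J := by
    by_contra! h
    refine hJu (Finset.eq_of_subset_of_card_le (Finset.subset_univ _) ?_)
    have himg : J.image (· - d) = J := by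
      refine Finset.eq_of_subset_of_card_le ?_ ?_
      · intro z hz
        obtain ⟨w, hw, rfl⟩ := Finset.mem_image.1 hz
        exact h w hw
      · rw [Finset.card_image_of_injective _ (sub_left_injective)]
    rw [hstable J hJ]
    intro t ht
    rw [← himg] at ht
    obtain ⟨w, hw, rfl⟩ := Finset.mem_image.1 ht
    simpa using hw
  have hex : ∃ k : ℕ, a + (k : ZMod m) * d ∉ J := by
    by_contra! h
    refine had ?_
    -- `m - 1` steps by `d` amount to one step back, to `a - d`.
    have := h (m - 1)
    rw [Nat.cast_sub (NeZero.one_le), ZMod.natCast_self] at this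
    convert this using 1
    push_cast
    ring
  set k := Nat.find hex with hk
  have hkn : a + (k : ZMod m) * d ∉ J := Nat.find_spec hex
  have hlt : ∀ i < k, a + (i : ZMod m) * d ∈ J := fun i hi => by
    have := Nat.find_min hex hi
    simpa using this
  have hk0 : k ≠ 0 := by
    intro h
    rw [h] at hkn
    simp [ha] at hkn
  obtain ⟨l, hl⟩ := Nat.exists_eq_succ_of_ne_zero hk0
  have hJeq : J = (Finset.range k).image (fun i : ℕ => a + (i : ZMod m) * d) := by
    by_contra hne
    set P := (Finset.range k).image (fun i : ℕ => a + (i : ZMod m) * d) with hP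
    have hPJ : P ⊆ J := by
      intro z hz
      obtain ⟨i, hi, rfl⟩ := Finset.mem_image.1 hz
      exact hlt i (Finset.mem_range.1 hi)
    have hex' : (J \ P).Nonempty := by
      rw [Finset.sdiff_nonempty]
      exact fun h => hne (Finset.Subset.antisymm h hPJ)
    have := hstable _ hex' ?_
    · have ha' : a ∈ J \ P := by rw [this]; exact Finset.mem_univ _
      refine (Finset.mem_sdiff.1 ha').2 (Finset.mem_image.2 ⟨0, ?_, by simp⟩)
      exact Finset.mem_range.2 (Nat.pos_of_ne_zero hk0)
    · intro t ht
      obtain ⟨htJ, htP⟩ := Finset.mem_sdiff.1 ht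
      have htd : t + d ∈ J := by
        by_contra htd
        have := hone t htJ (a + (l : ZMod m) * d) (hlt l (by omega)) htd (by
          rw [hl] at hkn
          convert hkn using 2
          push_cast
          ring)
        exact htP (Finset.mem_image.2 ⟨l, Finset.mem_range.2 (by omega), this.symm⟩)
      refine Finset.mem_sdiff.2 ⟨htd, fun h => ?_⟩
      obtain ⟨i, hi, hit⟩ := Finset.mem_image.1 h
      rcases i with _ | i
      · refine had ?_
        have : a = t + d := by simpa using hit
        rw [this]
        simpa using htJ
      · refine htP (Finset.mem_image.2 ⟨i, ?_, ?_⟩)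
        · rw [Finset.mem_range] at hi ⊢
          omega
        · push_cast at hit
          linear_combination hit
  have hinj : Set.InjOn (fun i : ℕ => a + (i : ZMod m) * d) (Finset.range k) := by
    have key : ∀ i j : ℕ, i < j → j < k → a + (i : ZMod m) * d ≠ a + (j : ZMod m) * d := by
      intro i j hij hjk h
      refine had ?_
      -- A repetition would make the run return to `a`, and the term just before the return is `a -
      -- d`.
      have := hlt (j - i - 1) (by omega)
      convert this using 1
      rw [Nat.cast_sub (by omega), Nat.cast_sub (by omega)]
      push_cast
      linear_combination h
    intro i hi j hj h
    rw [Finset.mem_coe, Finset.mem_range] at hi hj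
    rcases lt_trichotomy i j with hij | hij | hij
    · exact (key i j hij hj h).elim
    · exact hij
    · exact (key j i hij hi h.symm).elim
  have hcard : J.card = k := by
    rw [hJeq, Finset.card_image_of_injOn hinj, Finset.card_range]
  refine ⟨hJ, a, d, ?_, ?_⟩
  · rintro rfl
    exact hkn (by simpa using ha)
  · ext z
    rw [hcard]
    constructor
    · intro hz
      rw [hJeq] at hz
      obtain ⟨i, hi, rfl⟩ := Finset.mem_image.1 hz
      exact ⟨i, Finset.mem_range.1 hi, rfl⟩
    · rintro ⟨i, hi, rfl⟩
      exact hlt i hi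

variable {n : ℕ} {J : Finset (ZMod (2 * n + 1))}

theorem ZMod.eq_zero_of_add_self {n : ℕ} {x : ZMod (2 * n + 1)} (h : x + x = 0) : x = 0 := by
  have h1 : ((2 * n + 1 : ℕ) : ZMod (2 * n + 1)) = 0 := ZMod.natCast_self _
  push_cast at h1
  linear_combination (-(n : ZMod (2 * n + 1))) * h + x * h1

theorem ZMod.mem_of_add_self_mem {n : ℕ} (H : AddSubgroup (ZMod (2 * n + 1)))
    {x : ZMod (2 * n + 1)} (h : x + x ∈ H) : x ∈ H := by
  have h1 : ((2 * n + 1 : ℕ) : ZMod (2 * n + 1)) = 0 := ZMod.natCast_self _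
  push_cast at h1
  have h2 := H.nsmul_mem h (n + 1)
  convert h2 using 1
  rw [nsmul_eq_mul]
  push_cast
  linear_combination (-x) * h1

theorem IsSymbolSet.neg_notMem (hJ : IsSymbolSet n J) {x : ZMod (2 * n + 1)} (hx : x ∈ J) :
    -x ∉ J := by
  intro hnx
  have hne : x ≠ -x := by
    intro h
    have : x = 0 := ZMod.eq_zero_of_add_self (by nth_rewrite 2 [h]; simp)
    exact hJ.1 (this ▸ hx)
  have h1 := hJ.2.2 x hx
  rw [Finset.inter_eq_left.2 (by simp [Finset.insert_subset_iff, hx, hnx]),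
    Finset.card_pair hne] at h1
  omega

theorem IsSymbolSet.mem_or_neg_mem (hJ : IsSymbolSet n J) {x : ZMod (2 * n + 1)} (hx : x ≠ 0) :
    x ∈ J ∨ -x ∈ J := by
  have hdis : Disjoint J (-J) := by
    rw [Finset.disjoint_left]
    intro y hy hy'
    exact hJ.neg_notMem hy (Finset.mem_neg'.1 hy')
  have h0 : (0 : ZMod (2 * n + 1)) ∉ J ∪ -J := by
    simp [hJ.1, Finset.mem_neg']
  have hu : insert 0 (J ∪ -J) = Finset.univ := by
    refine Finset.eq_univ_of_card _ ?_
    rw [Finset.card_insert_of_notMem h0, Finset.card_union_of_disjoint hdis, Finset.card_neg,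
      hJ.2.1, ZMod.card]
    omega
  have : x ∈ insert 0 (J ∪ -J) := by rw [hu]; exact Finset.mem_univ _
  simpa [hx, Finset.mem_neg'] using this

/-- The decomposition is `J \ H` and `J ∩ H`, the latter proper in `H` because `0 ∉ J`. If `J \ H`
filled only part of a coset `x + H`, both `x + H` and `-x + H` would meet `J`. Each pair `±(x + k)`
contributes exactly one hole, and since the order is odd these cosets are disjoint: `|H|` distinct
holes. -/
theorem IsSymbolSet.isQuasiPeriodic (hJ : IsSymbolSet n J) (hne : J.Nonempty)
    {H : AddSubgroup (ZMod (2 * n + 1))} (hbot : H ≠ ⊥) (htop : H ≠ ⊤)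
    (hZ : ∀ Z : Finset (ZMod (2 * n + 1)),
      (∀ z ∈ Z, z ∉ insert 0 J ∧ ∃ s ∈ insert 0 J, z - s ∈ H) → Z.card < Nat.card H) :
    IsQuasiPeriodic (J : Set (ZMod (2 * n + 1))) := by
  classical
  refine ⟨by simpa using hne, H, hbot, htop, {x | x ∈ J ∧ x ∉ H}, {x | x ∈ J ∧ x ∈ H}, ?_, ?_, ?_,
    0, ?_⟩
  · ext x
    by_cases hx : x ∈ H <;> simp [hx]
  · rw [Set.disjoint_left]
    exact fun x hx hx' => hx.2 hx'.2
  · ext z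
    constructor
    · rintro ⟨x, ⟨hxJ, hxH⟩, h, hh, rfl⟩
      have hxh : x + h ∉ H := fun h' => hxH ((H.add_mem_cancel_right hh).1 h')
      refine ⟨?_, hxh⟩
      by_contra hxhJ
      have hneg : -(x + h) ∈ J := (hJ.mem_or_neg_mem (x := x + h) (by
        rintro h0
        exact hxh (h0 ▸ H.zero_mem))).resolve_left hxhJ
      set g : H → ZMod (2 * n + 1) := fun k => if x + k ∈ J then -(x + k) else x + k with hg
      have hginj : Function.Injective g := by
        intro k l hkl
        have hkey : ∀ k l : H, x + k ≠ -(x + l) := by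
          intro k l h
          apply hxH
          apply ZMod.mem_of_add_self_mem
          have : x + x = -(k : ZMod (2 * n + 1)) - l := by linear_combination h
          rw [this]
          exact H.sub_mem (H.neg_mem k.2) l.2
        have hkl' : (if x + k ∈ J then -(x + k) else x + k : ZMod (2 * n + 1)) =
          if x + l ∈ J then -(x + l) else x + l := hkl
        ext
        split_ifs at hkl'
        · simpa using hkl'
        · exact (hkey l k hkl'.symm).elim
        · exact (hkey k l hkl').elim
        · simpa using hkl'
      have := hZ (Finset.univ.image g) ?_
      · rw [Finset.card_image_of_injective _ hginj, Finset.card_univ,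
          Nat.card_eq_fintype_card] at this
        exact lt_irrefl _ this
      · intro z hz
        obtain ⟨k, -, rfl⟩ := Finset.mem_image.1 hz
        have hk0 : x + k ≠ 0 := by
          intro h0
          exact hxH ((H.add_mem_cancel_right k.2).1 (h0 ▸ H.zero_mem))
        change (if x + k ∈ J then -(x + k) else x + k : ZMod (2 * n + 1)) ∉ insert 0 J ∧
          ∃ s ∈ insert 0 J, (if x + k ∈ J then -(x + k) else x + k : ZMod (2 * n + 1)) - s ∈ H
        split_ifs with hk
        · refine ⟨?_, -(x + h), Finset.mem_insert_of_mem hneg, ?_⟩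
          · rw [Finset.mem_insert, not_or]
            exact ⟨neg_ne_zero.2 hk0, hJ.neg_notMem hk⟩
          · have : -(x + (k : ZMod (2 * n + 1))) - -(x + h) = h - k := by abel
            rw [this]
            exact H.sub_mem hh k.2
        · refine ⟨?_, x, by simp [hxJ], ?_⟩
          · rw [Finset.mem_insert, not_or]
            exact ⟨hk0, hk⟩
          · simp
    · intro hz
      exact ⟨z, hz, 0, H.zero_mem, by simp⟩
  · rw [zero_vadd]
    refine (Set.ssubset_iff_of_subset fun x hx => hx.2).2 ⟨0, H.zero_mem, fun h => hJ.1 h.1⟩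

/-- In a circulant tournament whose symbol set is neither an arithmetic progression nor
quasi-periodic, a set `Q` can dominate a set `P` only if `|P| + |Q| ≤ n`, unless one of them has at
most one element. -/
theorem IsSymbolSet.card_add_card_le (hJ : IsSymbolSet n J) (hAP : ¬ IsArithProg J)
    (hQP : ¬ IsQuasiPeriodic (J : Set (ZMod (2 * n + 1)))) {P Q : Finset (ZMod (2 * n + 1))}
    (hP : 2 ≤ P.card) (hQ : 2 ≤ Q.card) (hPQ : ∀ q ∈ Q, ∀ p ∈ P, p - q ∈ J) :
    P.card + Q.card ≤ n := by
  classical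
  by_contra! hlt
  have hne : J.Nonempty := by
    obtain ⟨p, hp⟩ := Finset.card_pos.1 (by omega : 0 < P.card)
    obtain ⟨q, hq⟩ := Finset.card_pos.1 (by omega : 0 < Q.card)
    exact ⟨_, hPQ q hq p hp⟩
  have hn : 0 < n := by rw [← hJ.2.1]; exact hne.card_pos
  have hSc : (insert 0 J).card = n + 1 := by rw [Finset.card_insert_of_notMem hJ.1, hJ.2.1]
  have hdis : Disjoint (P + insert 0 J) Q := by
    rw [Finset.disjoint_left]
    intro z hz hzQ
    obtain ⟨p, hp, s, hs, rfl⟩ := Finset.mem_add.1 hz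
    have h := hPQ _ hzQ p hp
    have e : p - (p + s) = -s := by abel
    rw [e] at h
    rcases Finset.mem_insert.1 hs with rfl | hs
    · exact hJ.1 (by simpa using h)
    · exact hJ.neg_notMem hs h
  have hcard := Finset.card_le_univ (P + insert 0 J ∪ Q)
  rw [Finset.card_union_of_disjoint hdis, ZMod.card] at hcard
  have hsep : IsTwoSeparating (insert 0 J) P := ⟨hP, by rw [ZMod.card]; omega⟩
  rcases exists_generator_or_subgroup_of_small_sumset (by omega) hsep (by omega) with
    ⟨d, hd, hdS⟩ | ⟨H, hbot, htop, hH⟩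
  · refine hAP (isArithProg_of_almost_stable hne ?_ hd ?_)
    · intro h
      exact hJ.1 (h ▸ Finset.mem_univ _)
    · intro x hx y hy hxd hyd
      by_contra hxy
      -- Negation turns an exit `z` of `J` into a new point `-z = -(z + d) + d` of the sumset, and
      -- only one new point is available.
      have hmem : ∀ z, z ∈ J → z + d ∉ J → -z ∈ insert 0 J + {0, d} ∧ -z ∉ insert 0 J := by
        intro z hz hzd
        constructor
        · refine Finset.mem_add.2 ⟨-(z + d), ?_, d, by simp, by ring⟩
          rw [Finset.mem_insert, neg_eq_zero]
          by_cases h0 : z + d = 0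
          · exact Or.inl h0
          · exact Or.inr ((hJ.mem_or_neg_mem h0).resolve_left hzd)
        · rw [Finset.mem_insert, neg_eq_zero, not_or]
          exact ⟨fun h => hJ.1 (h ▸ hz), hJ.neg_notMem hz⟩
      have hsub : insert 0 J ∪ {-x, -y} ⊆ insert 0 J + {0, d} := by
        refine Finset.union_subset (fun z hz => ?_) ?_
        · exact Finset.mem_add.2 ⟨z, hz, 0, by simp, by simp⟩
        · simp only [Finset.insert_subset_iff, Finset.singleton_subset_iff]
          exact ⟨(hmem x hx hxd).1, (hmem y hy hyd).1⟩
      have h2 := Finset.card_le_card hsub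
      rw [Finset.card_union_of_disjoint, Finset.card_pair (by simpa using hxy)] at h2
      · omega
      · rw [Finset.disjoint_right]
        intro z hz
        rcases Finset.mem_insert.1 hz with rfl | hz
        · exact (hmem x hx hxd).2
        · rw [Finset.mem_singleton.1 hz]
          exact (hmem y hy hyd).2
  · exact hQP (hJ.isQuasiPeriodic hne hbot htop hH)

end SymbolSets

/-! ### Rainbow triangles in three-coloured regular tournaments -/

section RainbowTriangles

variable {V : Type*} [DecidableEq V] {r : V → V → Prop} {χ : V → Fin 3}

/-- A three-coloured tournament without rainbow directed triangles is not strongly connected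
through the arcs that join different colours. -/
theorem exists_subset_dominating_of_rainbow_free
    (htot : ∀ x y, x ≠ y → r x y ∨ r y x) {K : Finset V} (hχ : ∀ i, ∃ x ∈ K, χ x = i)
    (hrain : ∀ x ∈ K, ∀ y ∈ K, ∀ z ∈ K, χ x ≠ χ y → χ y ≠ χ z → χ z ≠ χ x →
      r x y → r y z → ¬ r z x) :
    ∃ T ⊆ K, T.Nonempty ∧ T ≠ K ∧ ∀ x ∈ K, x ∉ T → ∀ t ∈ T, χ x ≠ χ t → r t x := by
  classical
  have htot' : ∀ x y, χ x ≠ χ y → ¬ r x y → r y x := fun x y h h' =>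
    (htot x y fun e => h (by rw [e])).resolve_left h'
  set f : V → Finset V := fun x => K.filter (fun y => χ y = 0 ∧ r x y) with hf
  have hmemf : ∀ x y, y ∈ f x ↔ y ∈ K ∧ χ y = 0 ∧ r x y := fun x y => by simp [hf]
  set O := K.filter (fun x => χ x ≠ 0) with hO
  have hmemO : ∀ x, x ∈ O ↔ x ∈ K ∧ χ x ≠ 0 := fun x => by simp [hO]
  -- An arc from colour `1` to `2`, or back, reverses inclusion of the colour-`0` out-neighbourhoods
  -- `f`: a vertex of `f y` outside `f x` closes a rainbow triangle. So `f` is comparable across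
  -- these two colours.
  have hmono : ∀ x ∈ O, ∀ y ∈ O, χ x ≠ χ y → r x y → f y ⊆ f x := by
    intro x hx y hy hxy hr z hz
    rw [hmemO] at hx hy
    rw [hmemf] at hz ⊢
    refine ⟨hz.1, hz.2.1, ?_⟩
    by_contra h
    exact hrain x hx.1 y hy.1 z hz.1 hxy (by rw [hz.2.1]; exact hy.2)
      (by rw [hz.2.1]; exact hx.2.symm) hr hz.2.2
      (htot' x z (by rw [hz.2.1]; exact hx.2) h)
  have hcomp : ∀ x ∈ O, ∀ y ∈ O, χ x ≠ χ y → f x ⊆ f y ∨ f y ⊆ f x := by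
    intro x hx y hy hxy
    by_cases h : r x y
    · exact Or.inr (hmono x hx y hy hxy h)
    · exact Or.inl (hmono y hy x hx hxy.symm (htot' x y hxy h))
  obtain ⟨x1, hx1, hx1c⟩ := hχ 1
  obtain ⟨x0, hx0, hx0c⟩ := hχ 0
  have hx1O : x1 ∈ O := (hmemO _).2 ⟨hx1, by rw [hx1c]; decide⟩
  obtain ⟨u, hu, humax⟩ := Finset.exists_max_image O (fun x => (f x).card) ⟨x1, hx1O⟩
  have hmax : ∀ x ∈ O, f u ⊆ f x → f x = f u := fun x hx h =>
    (Finset.eq_of_subset_of_card_le h (humax x hx)).symm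
  -- If both nonzero colours attain the maximal `f u`, it contains every `f x`. Otherwise the colour
  -- of `u` has vertices whose `f` lies strictly above all those of the other nonzero colour, and
  -- they form the core of `T`.
  by_cases hA : ∃ v ∈ O, χ v ≠ χ u ∧ f v = f u
  · obtain ⟨v, hv, hvu, hfv⟩ := hA
    have hle : ∀ x ∈ O, f x ⊆ f u := by
      intro x hx
      by_cases hxu : χ x = χ u
      · rcases hcomp x hx v hv (by rw [hxu]; exact hvu.symm) with h | h
        · rwa [hfv] at h
        · rw [hmax x hx (hfv ▸ h)]
      · rcases hcomp x hx u hu hxu with h | h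
        · exact h
        · rw [hmax x hx h]
    set T := O.filter (fun x => f x = f u) ∪ K.filter (fun x => χ x = 0 ∧ x ∉ f u) with hT
    have hmemT : ∀ x, x ∈ T ↔ (x ∈ O ∧ f x = f u) ∨ (x ∈ K ∧ χ x = 0 ∧ x ∉ f u) :=
      fun x => by simp [hT]
    by_cases hTK : T = K
    · have hempty : ∀ x ∈ O, f x = ∅ := by
        have h0 : f u = ∅ := by
          refine Finset.eq_empty_of_forall_notMem fun m hm => ?_
          have h1 := (hmemf _ _).1 hm
          have h2 : m ∈ T := by rw [hTK]; exact h1.1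
          rcases (hmemT m).1 h2 with h | h
          · exact ((hmemO m).1 h.1).2 h1.2.1
          · exact h.2.2 hm
        intro x hx
        exact Finset.subset_empty.1 (h0 ▸ hle x hx)
      refine ⟨K.filter (fun x => χ x = 0), Finset.filter_subset _ _,
        ⟨x0, Finset.mem_filter.2 ⟨hx0, hx0c⟩⟩, ?_, ?_⟩
      · intro h
        have : x1 ∈ K.filter (fun x => χ x = 0) := by rw [h]; exact hx1
        exact ((hmemO x1).1 hx1O).2 (Finset.mem_filter.1 this).2
      · intro x hx hxT t ht hxt
        rw [Finset.mem_filter] at ht hxT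
        have hxO : x ∈ O := (hmemO x).2 ⟨hx, fun h => hxT ⟨hx, h⟩⟩
        refine htot' x t hxt fun hr => ?_
        have : t ∈ f x := (hmemf _ _).2 ⟨ht.1, ht.2, hr⟩
        rw [hempty x hxO] at this
        exact Finset.notMem_empty _ this
    · refine ⟨T, ?_, ⟨u, (hmemT u).2 (Or.inl ⟨hu, rfl⟩)⟩, hTK, ?_⟩
      · intro x hx
        rcases (hmemT x).1 hx with h | h
        · exact ((hmemO x).1 h.1).1
        · exact h.1
      · intro x hx hxT t ht hxt
        rw [hmemT, not_or] at hxT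
        rw [hmemT] at ht
        by_cases hx0 : χ x = 0
        · have hxu : x ∈ f u := by
            by_contra h
            exact hxT.2 ⟨hx, hx0, h⟩
          rcases ht with ht | ht
          · rw [← ht.2, hmemf] at hxu
            exact hxu.2.2
          · exact (hxt (by rw [hx0, ht.2.1])).elim
        · have hxO : x ∈ O := (hmemO x).2 ⟨hx, hx0⟩
          refine htot' x t hxt fun hr => ?_
          rcases ht with ht | ht
          · have h := hmono x hxO t ht.1 hxt hr
            rw [ht.2] at h
            exact hxT.1 ⟨hxO, hmax x hxO h⟩
          · exact ht.2.2 (hle x hxO ((hmemf _ _).2 ⟨ht.1, ht.2.1, hr⟩))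
  · push Not at hA
    have hlt : ∀ x ∈ O, χ x ≠ χ u → f x ⊂ f u := by
      intro x hx hxu
      rcases hcomp x hx u hu hxu with h | h
      · exact Finset.ssubset_iff_subset_ne.2 ⟨h, hA x hx hxu⟩
      · exact (hA x hx hxu (hmax x hx h)).elim
    set T₁ := O.filter (fun x => χ x = χ u ∧ ∀ y ∈ O, χ y ≠ χ u → f y ⊂ f x) with hT₁
    have hmemT₁ : ∀ x, x ∈ T₁ ↔ x ∈ O ∧ χ x = χ u ∧ ∀ y ∈ O, χ y ≠ χ u → f y ⊂ f x :=
      fun x => by simp [hT₁]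
    have hout : ∀ x ∈ O, x ∉ T₁ → ∀ t ∈ T₁, f x ⊆ f t := by
      intro x hx hxT t ht
      rw [hmemT₁] at ht
      by_cases hxu : χ x = χ u
      · rw [hmemT₁] at hxT
        push Not at hxT
        obtain ⟨y, hy, hyu, hyx⟩ := hxT hx hxu
        have hxy : f x ⊆ f y := by
          rcases hcomp x hx y hy (by rw [hxu]; exact hyu.symm) with h | h
          · exact h
          · by_contra h'
            exact hyx ⟨h, h'⟩
        exact hxy.trans (ht.2.2 y hy hyu).1
      · exact (ht.2.2 x hx hxu).1
    set T := T₁ ∪ K.filter (fun x => χ x = 0 ∧ ∀ y ∈ O, y ∉ T₁ → x ∉ f y) with hT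
    have hmemT : ∀ x, x ∈ T ↔ x ∈ T₁ ∨ (x ∈ K ∧ χ x = 0 ∧ ∀ y ∈ O, y ∉ T₁ → x ∉ f y) :=
      fun x => by simp [hT]
    refine ⟨T, ?_, ⟨u, (hmemT u).2 (Or.inl ((hmemT₁ u).2 ⟨hu, rfl, hlt⟩))⟩, ?_, ?_⟩
    · intro x hx
      rcases (hmemT x).1 hx with h | h
      · exact ((hmemO x).1 ((hmemT₁ x).1 h).1).1
      · exact h.1
    · intro hTK
      obtain ⟨w, hw, hwc⟩ : ∃ w ∈ O, χ w ≠ χ u := by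
        obtain ⟨i, hi0, hiu⟩ : ∃ i : Fin 3, i ≠ 0 ∧ i ≠ χ u := by
          generalize χ u = j
          revert j
          decide
        obtain ⟨w, hw, hwi⟩ := hχ i
        exact ⟨w, (hmemO w).2 ⟨hw, by rwa [hwi]⟩, by rwa [hwi]⟩
      have : w ∈ T := by rw [hTK]; exact ((hmemO w).1 hw).1
      rcases (hmemT w).1 this with h | h
      · exact hwc ((hmemT₁ w).1 h).2.1
      · exact ((hmemO w).1 hw).2 h.2.1
    · intro x hx hxT t ht hxt
      rw [hmemT, not_or] at hxT
      rw [hmemT] at ht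
      by_cases hx0 : χ x = 0
      · rcases ht with ht | ht
        · have h := hxT.2
          push Not at h
          obtain ⟨y, hy, hyT, hxy⟩ := h hx hx0
          exact ((hmemf _ _).1 (hout y hy hyT t ht hxy)).2.2
        · exact (hxt (by rw [hx0, ht.2.1])).elim
      · have hxO : x ∈ O := (hmemO x).2 ⟨hx, hx0⟩
        refine htot' x t hxt fun hr => ?_
        rcases ht with ht | ht
        · have ht' := (hmemT₁ t).1 ht
          have h := hmono x hxO t ht'.1 hxt hr
          exact (ht'.2.2 x hxO (by rwa [← ht'.2.1])).2 h
        · exact ht.2.2 x hxO hxT.1 ((hmemf _ _).2 ⟨ht.1, ht.2.1, hr⟩)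

/-- In a regular tournament of order `2 * n + 1` in which two sets, one dominating the other, have
together at most `n` elements unless one of them is trivial, every three-colouring has a rainbow
directed triangle. -/
theorem exists_rainbow_triangle [Fintype V] {n : ℕ} (htot : ∀ x y, x ≠ y → r x y ∨ r y x)
    (hcard : Fintype.card V = 2 * n + 1)
    (hout : ∀ x (P : Finset V), (∀ p ∈ P, r x p) → P.card ≤ n)
    (hin : ∀ x (P : Finset V), (∀ p ∈ P, r p x) → P.card ≤ n)
    (hdom : ∀ P Q : Finset V, 2 ≤ P.card → 2 ≤ Q.card → (∀ q ∈ Q, ∀ p ∈ P, r q p) →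
      P.card + Q.card ≤ n)
    (hχ : Function.Surjective χ) :
    ∃ x y z, χ x ≠ χ y ∧ χ y ≠ χ z ∧ χ z ≠ χ x ∧ r x y ∧ r y z ∧ r z x := by
  classical
  by_contra! hrain
  have hdom' : ∀ P Q : Finset V, P.Nonempty → Q.Nonempty → (∀ q ∈ Q, ∀ p ∈ P, r q p) →
      P.card + Q.card ≤ n ∨ (P.card + Q.card ≤ n + 1 ∧ (P.card = 1 ∨ Q.card = 1)) := by
    intro P Q hP hQ h
    have h1 := hP.card_pos
    have h2 := hQ.card_pos
    obtain ⟨p, hp⟩ := hP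
    obtain ⟨q, hq⟩ := hQ
    have h3 := hin p Q (fun q hq => h q hq p hp)
    have h4 := hout q P (fun p hp => h q hq p hp)
    by_cases h5 : 2 ≤ P.card ∧ 2 ≤ Q.card
    · exact Or.inl (hdom P Q h5.1 h5.2 h)
    · right
      omega
  -- `C U` says that all arcs between `U` and its complement joining different colours leave `U`.
  -- `U` and `U'` are consecutive such sets around the middle size.
  let C : Finset V → Prop := fun U => ∀ x, x ∉ U → ∀ u ∈ U, χ x ≠ χ u → r u x
  obtain ⟨U, hU, hUmax⟩ := Finset.exists_max_image
    (Finset.univ.filter (fun U : Finset V => C U ∧ U.card ≤ n)) Finset.card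
    ⟨∅, by simp [C]⟩
  simp only [Finset.mem_filter, Finset.mem_univ, true_and] at hU hUmax
  obtain ⟨hUC, hUn⟩ := hU
  have hUss : U ⊂ Finset.univ := by
    rw [Finset.ssubset_univ_iff]
    rintro rfl
    rw [Finset.card_univ] at hUn
    omega
  obtain ⟨U', hU', hUmin⟩ := Finset.exists_min_image
    (Finset.univ.filter (fun U' : Finset V => C U' ∧ U ⊂ U')) Finset.card
    ⟨Finset.univ, by simp [C, hUss]⟩
  simp only [Finset.mem_filter, Finset.mem_univ, true_and] at hU' hUmin
  obtain ⟨hUC', hss⟩ := hU'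
  have hlt := Finset.card_lt_card hss
  have hn' : n + 1 ≤ U'.card := by
    by_contra! h
    have := hUmax U' ⟨hUC', by omega⟩
    omega
  set K := U' \ U with hK
  set W := U'ᶜ with hW
  have hKc : K.card + U.card = U'.card := Finset.card_sdiff_add_card_eq_card hss.1
  have hWc : U'.card + W.card = 2 * n + 1 := by rw [hW, Finset.card_add_card_compl, hcard]
  have hmiss : ∃ i, ∀ x ∈ K, χ x ≠ i := by
    by_contra! h
    obtain ⟨T, hTK, hTne, hTK', hT⟩ := exists_subset_dominating_of_rainbow_free htot h
      (fun x _ y _ z _ => hrain x y z)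
    have hTK'' := Finset.card_lt_card (Finset.ssubset_iff_subset_ne.2 ⟨hTK, hTK'⟩)
    have hdis : Disjoint U T := Finset.disjoint_right.2 fun t ht =>
      (Finset.mem_sdiff.1 (hTK ht)).2
    have hUT := Finset.card_union_of_disjoint hdis
    have := hUmin (U ∪ T) ⟨?_, ?_⟩
    · omega
    · intro x hx y hy hxy
      rw [Finset.mem_union, not_or] at hx
      rcases Finset.mem_union.1 hy with hy | hy
      · exact hUC x hx.1 y hy hxy
      · by_cases hxU' : x ∈ U'
        · exact hT x (Finset.mem_sdiff.2 ⟨hxU', hx.1⟩) hx.2 y hy hxy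
        · exact hUC' x hxU' y (Finset.mem_sdiff.1 (hTK hy)).1 hxy
    · refine Finset.ssubset_iff_subset_ne.2 ⟨Finset.subset_union_left, fun h => ?_⟩
      rw [← h] at hUT
      have := hTne.card_pos
      omega
  have hmemW : ∀ x, x ∈ W ↔ x ∉ U' := fun x => Finset.mem_compl
  have hmemK : ∀ x, x ∈ K ↔ x ∈ U' ∧ x ∉ U := fun x => Finset.mem_sdiff
  have hcases : ∀ x, x ∈ U ∨ x ∈ K ∨ x ∈ W := fun x => by
    rw [hmemW, hmemK]
    tauto
  -- the vertices of a colour missing from `K`, inside `U` and inside `W`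
  have hsplit : ∀ i, (∀ x ∈ K, χ x ≠ i) →
      (U.filter (χ · = i)).Nonempty ∧ (W.filter (χ · = i)).Nonempty ∧
      (∀ q ∈ U.filter (χ · = i), ∀ p ∈ K ∪ W.filter (χ · ≠ i), r q p) ∧
      (∀ q ∈ K ∪ U.filter (χ · ≠ i), ∀ p ∈ W.filter (χ · = i), r q p) ∧
      (K ∪ W.filter (χ · ≠ i)).card + (W.filter (χ · = i)).card + U.card = 2 * n + 1 ∧
      (K ∪ U.filter (χ · ≠ i)).card + (U.filter (χ · = i)).card + W.card = 2 * n + 1 := by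
    intro i hi
    have hUW : ∀ q ∈ U.filter (χ · = i), ∀ p ∈ K ∪ W.filter (χ · ≠ i), r q p := by
      intro q hq p hp
      rw [Finset.mem_filter] at hq
      rcases Finset.mem_union.1 hp with hp | hp
      · exact hUC p ((hmemK p).1 hp).2 q hq.1 (by rw [hq.2]; exact hi p hp)
      · rw [Finset.mem_filter, hmemW] at hp
        exact hUC p (fun h => hp.1 (hss.1 h)) q hq.1 (by rw [hq.2]; exact hp.2)
    have hWU : ∀ q ∈ K ∪ U.filter (χ · ≠ i), ∀ p ∈ W.filter (χ · = i), r q p := by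
      intro q hq p hp
      rw [Finset.mem_filter, hmemW] at hp
      rcases Finset.mem_union.1 hq with hq | hq
      · exact hUC' p hp.1 q ((hmemK q).1 hq).1 (by rw [hp.2]; exact (hi q hq).symm)
      · rw [Finset.mem_filter] at hq
        exact hUC' p hp.1 q (hss.1 hq.1) (by rw [hp.2]; exact hq.2.symm)
    have hd1 : Disjoint K (W.filter (χ · ≠ i)) := Finset.disjoint_left.2 fun x hx hx' =>
      (hmemW x).1 (Finset.mem_filter.1 hx').1 ((hmemK x).1 hx).1
    have hd2 : Disjoint K (U.filter (χ · ≠ i)) := Finset.disjoint_left.2 fun x hx hx' =>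
      ((hmemK x).1 hx).2 (Finset.mem_filter.1 hx').1
    have hc1 := Finset.card_union_of_disjoint hd1
    have hc2 := Finset.card_union_of_disjoint hd2
    have hcW : (W.filter (χ · = i)).card + (W.filter (χ · ≠ i)).card = W.card :=
      Finset.card_filter_add_card_filter_not _
    have hcU : (U.filter (χ · = i)).card + (U.filter (χ · ≠ i)).card = U.card :=
      Finset.card_filter_add_card_filter_not _
    obtain ⟨a, ha⟩ := hχ i
    refine ⟨?_, ?_, hUW, hWU, by omega, by omega⟩
    -- If `U` had no vertex of colour `i`, any vertex of that colour would be in `W` and dominated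
    -- by all of `U'`, exceeding in-degree `n`. The other case is symmetric, with out-degrees.
    · by_contra hne
      rw [Finset.not_nonempty_iff_eq_empty] at hne
      have haW : a ∈ W.filter (χ · = i) := by
        rcases hcases a with h | h | h
        · have : a ∈ U.filter (χ · = i) := Finset.mem_filter.2 ⟨h, ha⟩
          rw [hne] at this
          exact (Finset.notMem_empty _ this).elim
        · exact (hi a h ha).elim
        · exact Finset.mem_filter.2 ⟨h, ha⟩
      have := hin a _ (fun q hq => hWU q hq a haW)
      rw [hne, Finset.card_empty] at hcU
      omega
    · by_contra hne
      rw [Finset.not_nonempty_iff_eq_empty] at hne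
      have haU : a ∈ U.filter (χ · = i) := by
        rcases hcases a with h | h | h
        · exact Finset.mem_filter.2 ⟨h, ha⟩
        · exact (hi a h ha).elim
        · have : a ∈ W.filter (χ · = i) := Finset.mem_filter.2 ⟨h, ha⟩
          rw [hne] at this
          exact (Finset.notMem_empty _ this).elim
      have := hout a _ (fun p hp => hUW a haU p hp)
      rw [hne, Finset.card_empty] at hcW
      omega
  have hKne : K.Nonempty := Finset.card_pos.1 (by omega)
  by_cases hK1 : K.card = 1
  · obtain ⟨v, hv⟩ := Finset.card_eq_one.1 hK1
    have hcol : ∀ i, i ≠ χ v → ∃ b ∈ U, χ b = i ∧ ∀ x ∈ U, ¬ r b x := by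
      intro i hi
      have hiK : ∀ x ∈ K, χ x ≠ i := by
        intro x hx
        rw [hv, Finset.mem_singleton] at hx
        rw [hx]
        exact hi.symm
      obtain ⟨h1, h2, h3, h4, h5, h6⟩ := hsplit i hiK
      have hKW : (K ∪ W.filter (χ · ≠ i)).Nonempty := hKne.mono Finset.subset_union_left
      have hKU : (K ∪ U.filter (χ · ≠ i)).Nonempty := hKne.mono Finset.subset_union_left
      have h7 := hdom' _ _ hKW h1 h3
      have h8 := hdom' _ _ h2 hKU h4
      have h9 : (U.filter (χ · = i)).card < U.card ∨ (W.filter (χ · = i)).card < W.card := by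
        obtain ⟨j, hji, hjv⟩ : ∃ j : Fin 3, j ≠ i ∧ j ≠ χ v := by
          have hfin : ∀ i k : Fin 3, ∃ j, j ≠ i ∧ j ≠ k := by decide
          exact hfin i (χ v)
        obtain ⟨x, hx⟩ := hχ j
        have hlt : ∀ Y : Finset V, x ∈ Y → (Y.filter (χ · = i)).card < Y.card := by
          intro Y hxY
          refine Finset.card_lt_card (Finset.filter_ssubset.2 ⟨x, hxY, ?_⟩)
          rwa [hx]
        rcases hcases x with h | h | h
        · exact Or.inl (hlt U h)
        · rw [hv, Finset.mem_singleton] at h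
          exact (hjv (by rw [← hx, h])).elim
        · exact Or.inr (hlt W h)
      -- With `|K| = 1` the two dominating pairs total `2 * n + 2`, so both bounds are tight with a
      -- singleton side. If that side were `K ∪ W.filter (χ · ≠ i)`, colour `i` would fill `U` and
      -- `W`, against `h9`. So `b` spends all its `n` out-arcs outside `U`.
      have hb1 : (U.filter (χ · = i)).card = 1 := by omega
      obtain ⟨b, hb⟩ := Finset.card_pos.1 (by omega : 0 < (U.filter (χ · = i)).card)
      refine ⟨b, (Finset.mem_filter.1 hb).1, (Finset.mem_filter.1 hb).2, fun x hx hr => ?_⟩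
      have hxn : x ∉ K ∪ W.filter (χ · ≠ i) := by
        rw [Finset.mem_union, not_or]
        refine ⟨fun h => ((hmemK x).1 h).2 hx, fun h => ?_⟩
        exact (hmemW x).1 (Finset.mem_filter.1 h).1 (hss.1 hx)
      have := hout b (insert x (K ∪ W.filter (χ · ≠ i))) (by
        intro p hp
        rcases Finset.mem_insert.1 hp with rfl | hp
        · exact hr
        · exact h3 b hb p hp)
      rw [Finset.card_insert_of_notMem hxn] at this
      omega
    obtain ⟨i, j, hij, hi, hj⟩ : ∃ i j : Fin 3, i ≠ j ∧ i ≠ χ v ∧ j ≠ χ v := by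
      generalize χ v = k
      revert k
      decide
    obtain ⟨b, hb, hbi, hb'⟩ := hcol i hi
    obtain ⟨c, hc, hcj, hc'⟩ := hcol j hj
    -- Two such vertices `b` and `c` of different colours lie in `U`, and neither may dominate the
    -- other.
    rcases htot b c (fun h => hij (by rw [← hbi, ← hcj, h])) with h | h
    · exact hb' c hc h
    · exact hc' b hb h
  · obtain ⟨i, hi⟩ := hmiss
    obtain ⟨h1, h2, h3, h4, h5, h6⟩ := hsplit i hi
    have hKW : (K ∪ W.filter (χ · ≠ i)).Nonempty := hKne.mono Finset.subset_union_left
    have hKU : (K ∪ U.filter (χ · ≠ i)).Nonempty := hKne.mono Finset.subset_union_left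
    have h7 := hdom' _ _ hKW h1 h3
    have h8 := hdom' _ _ h2 hKU h4
    have := hKne.card_pos
    -- The two dominating pairs total `2 * n + 1 + |K|`, which exceeds `2 * n + 2` once `|K| ≥ 2`.
    omega

end RainbowTriangles

/-! ### The disconnection number and keenness -/

section Keen

variable {n : ℕ} {J : Finset (ZMod (2 * n + 1))}

/-- In a circulant tournament whose symbol set is neither an arithmetic progression nor
quasi-periodic, any vertex labelling with three distinct values has a rainbow directed triangle. -/
theorem IsSymbolSet.exists_rainbow_triangle (hJ : IsSymbolSet n J) (hAP : ¬ IsArithProg J)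
    (hQP : ¬ IsQuasiPeriodic (J : Set (ZMod (2 * n + 1)))) {α : Type*}
    (f : ZMod (2 * n + 1) → α) {a b c : ZMod (2 * n + 1)} (hab : f a ≠ f b) (hac : f a ≠ f c)
    (hbc : f b ≠ f c) :
    ∃ x y z, f x ≠ f y ∧ f y ≠ f z ∧ f z ≠ f x ∧ (circulantTournament J).Adj x y ∧
      (circulantTournament J).Adj y z ∧ (circulantTournament J).Adj z x := by
  classical
  let χ : ZMod (2 * n + 1) → Fin 3 := fun x => if f x = f a then 0 else if f x = f b then 1 else 2
  have hne : ∀ x y, χ x ≠ χ y → f x ≠ f y := fun x y h e => h (by simp [χ, e])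
  have hχ : Function.Surjective χ := by
    intro i
    fin_cases i
    · exact ⟨a, by simp [χ]⟩
    · exact ⟨b, by simp [χ, hab.symm]⟩
    · exact ⟨c, by simp [χ, hac.symm, hbc.symm]⟩
  have htot : ∀ x y, x ≠ y →
      (circulantTournament J).Adj x y ∨ (circulantTournament J).Adj y x := by
    intro x y hxy
    have := hJ.mem_or_neg_mem (sub_ne_zero.2 hxy.symm)
    rwa [neg_sub] at this
  have hout : ∀ x (P : Finset (ZMod (2 * n + 1))),
      (∀ p ∈ P, (circulantTournament J).Adj x p) → P.card ≤ n := by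
    intro x P hP
    exact (Finset.card_le_card_of_injOn (· - x) (fun p hp => hP p hp)
      sub_left_injective.injOn).trans hJ.2.1.le
  have hin : ∀ x (P : Finset (ZMod (2 * n + 1))),
      (∀ p ∈ P, (circulantTournament J).Adj p x) → P.card ≤ n := by
    intro x P hP
    exact (Finset.card_le_card_of_injOn (x - ·) (fun p hp => hP p hp)
      sub_right_injective.injOn).trans hJ.2.1.le
  obtain ⟨x, y, z, hxy, hyz, hzx, h⟩ := _root_.exists_rainbow_triangle htot (ZMod.card _) hout hin
    (fun P Q hP hQ h => hJ.card_add_card_le hAP hQP hP hQ h) hχ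
  exact ⟨x, y, z, hne x y hxy, hne y z hyz, hne z x hzx, h⟩

theorem IsSymbolSet.card_parts_le_two (hJ : IsSymbolSet n J) (hAP : ¬ IsArithProg J)
    (hQP : ¬ IsQuasiPeriodic (J : Set (ZMod (2 * n + 1))))
    {π : Finpartition (Finset.univ : Finset (ZMod (2 * n + 1)))}
    (hπ : (circulantTournament J).IsExternallyC3Free π) : π.parts.card ≤ 2 := by
  by_contra! h
  obtain ⟨A, hA, B, hB, C, hC, hAB, hAC, hBC⟩ := Finset.two_lt_card.1 h
  have hpart : ∀ A ∈ π.parts, ∃ a, π.part a = A := fun A hA => by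
    obtain ⟨a, ha⟩ := π.nonempty_of_mem_parts hA
    exact ⟨a, π.part_eq_of_mem hA ha⟩
  obtain ⟨a, rfl⟩ := hpart A hA
  obtain ⟨b, rfl⟩ := hpart B hB
  obtain ⟨c, rfl⟩ := hpart C hC
  obtain ⟨x, y, z, hxy, hyz, hzx, h1, h2, h3⟩ :=
    hJ.exists_rainbow_triangle hAP hQP π.part hAB hAC hBC
  exact hπ x y z (ne_of_apply_ne _ hxy) (ne_of_apply_ne _ hyz) (ne_of_apply_ne _ hzx)
    ⟨⟨h1, hxy⟩, ⟨h2, hyz⟩, ⟨h3, hzx⟩⟩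

/-- Labelling vertices by their component, every arc of a rainbow triangle joins different
components and so must have been deleted, which puts the triangle in `D`. -/
theorem IsSymbolSet.card_connectedComponent_le_two (hJ : IsSymbolSet n J) (hAP : ¬ IsArithProg J)
    (hQP : ¬ IsQuasiPeriodic (J : Set (ZMod (2 * n + 1)))) {D : Digraph (ZMod (2 * n + 1))}
    (hD : D.IsC3Free) :
    Nat.card (circulantTournament J \ D).toSimpleGraphInclusive.ConnectedComponent ≤ 2 := by
  classical
  by_contra! h
  set G := (circulantTournament J \ D).toSimpleGraphInclusive with hG
  have : Fintype G.ConnectedComponent := Fintype.ofFinite _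
  rw [Nat.card_eq_fintype_card, Fintype.two_lt_card_iff] at h
  obtain ⟨A, B, C, hAB, hAC, hBC⟩ := h
  obtain ⟨a, rfl⟩ := A.exists_rep
  obtain ⟨b, rfl⟩ := B.exists_rep
  obtain ⟨c, rfl⟩ := C.exists_rep
  obtain ⟨x, y, z, hxy, hyz, hzx, h1, h2, h3⟩ :=
    hJ.exists_rainbow_triangle hAP hQP G.connectedComponentMk hAB hAC hBC
  have hadj : ∀ u v, G.connectedComponentMk u ≠ G.connectedComponentMk v →
      (circulantTournament J).Adj u v → D.Adj u v := by
    intro u v huv h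
    by_contra hD
    refine huv (SimpleGraph.ConnectedComponent.eq.2 (SimpleGraph.Adj.reachable ?_))
    rw [hG, Digraph.toSimpleGraphInclusive, SimpleGraph.fromRel_adj]
    exact ⟨ne_of_apply_ne _ huv, Or.inl ⟨h, hD⟩⟩
  exact hD x y z (ne_of_apply_ne _ hxy) (ne_of_apply_ne _ hyz) (ne_of_apply_ne _ hzx)
    ⟨hadj x y hxy h1, hadj y z hyz h2, hadj z x hzx h3⟩

theorem Digraph.two_le_card_connectedComponent_of_isolated {V : Type*} [Finite V] (D : Digraph V)
    {a b : V} (hab : a ≠ b) (ha : ∀ x, ¬ D.Adj a x ∧ ¬ D.Adj x a) :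
    2 ≤ Nat.card D.toSimpleGraphInclusive.ConnectedComponent := by
  classical
  have : Fintype D.toSimpleGraphInclusive.ConnectedComponent := Fintype.ofFinite _
  rw [Nat.card_eq_fintype_card]
  refine Fintype.one_lt_card_iff.2 ⟨D.toSimpleGraphInclusive.connectedComponentMk a,
    D.toSimpleGraphInclusive.connectedComponentMk b, fun h => ?_⟩
  obtain ⟨p⟩ := SimpleGraph.ConnectedComponent.eq.1 h
  cases p with
  | nil => exact hab rfl
  | cons h _ =>
    rw [Digraph.toSimpleGraphInclusive, SimpleGraph.fromRel_adj] at h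
    rcases h.2 with h | h
    · exact (ha _).1 h
    · exact (ha _).2 h

theorem IsSymbolSet.omega3_eq_two (hn : 0 < n) (hJ : IsSymbolSet n J) (hAP : ¬ IsArithProg J)
    (hQP : ¬ IsQuasiPeriodic (J : Set (ZMod (2 * n + 1)))) :
    (circulantTournament J).omega3 = 2 := by
  have : Fact (1 < 2 * n + 1) := ⟨by omega⟩
  have hub : ∀ k ∈ {k : ℕ | ∃ D' : Digraph (ZMod (2 * n + 1)), D' ≤ circulantTournament J ∧
      D'.IsC3Free ∧ k = Nat.card (circulantTournament J \ D').toSimpleGraphInclusive.ConnectedComponent},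
      k ≤ 2 := by
    rintro k ⟨D', -, hD', rfl⟩
    exact hJ.card_connectedComponent_le_two hAP hQP hD'
  -- Deleting the star at `0` isolates `0`; a star has no triangle, since every triangle has an arc
  -- avoiding `0`.
  let D : Digraph (ZMod (2 * n + 1)) :=
    { Adj := fun u v => (circulantTournament J).Adj u v ∧ (u = 0 ∨ v = 0) }
  have hD : D.IsC3Free := by
    rintro u v w huv hvw hwu ⟨h1, h2, h3⟩
    have h1 := h1.2
    have h2 := h2.2
    have h3 := h3.2
    grind
  have htwo : 2 ≤ Nat.card (circulantTournament J \ D).toSimpleGraphInclusive.ConnectedComponent :=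
    Digraph.two_le_card_connectedComponent_of_isolated _ (zero_ne_one (α := ZMod (2 * n + 1)))
      fun x => ⟨fun h => h.2 ⟨h.1, Or.inl rfl⟩, fun h => h.2 ⟨h.1, Or.inr rfl⟩⟩
  refine le_antisymm (csSup_le' hub) (htwo.trans (le_csSup ⟨2, hub⟩ ⟨D, fun u v h => h.1, hD, rfl⟩))

end Keen

theorem mainTheorem7 (n : ℕ) (hn : 0 < n) (J : Finset (ZMod (2 * n + 1)))
    (hJ : IsSymbolSet n J) (hAP : ¬ IsArithProg J)
    (hQP : ¬ IsQuasiPeriodic (J : Set (ZMod (2 * n + 1)))) :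
    (circulantTournament J).IsOmega3Keen := by
  have hV : Fintype.card (ZMod (2 * n + 1)) = 2 * n + 1 := ZMod.card _
  have hc : (({0} : Finset (ZMod (2 * n + 1)))ᶜ).card = 2 * n := by
    rw [Finset.card_compl, Finset.card_singleton, hV]
    omega
  constructor
  · have hne : ({0} : Finset (ZMod (2 * n + 1))) ≠ {0}ᶜ := by
      intro h
      have : (0 : ZMod (2 * n + 1)) ∈ ({0} : Finset (ZMod (2 * n + 1)))ᶜ := by rw [← h]; simp
      simp at this
    have hne0 : ({0} : Finset (ZMod (2 * n + 1)))ᶜ ≠ ⊥ := fun h => by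
      rw [h, Finset.bot_eq_empty, Finset.card_empty] at hc
      omega
    let π : Finpartition (Finset.univ : Finset (ZMod (2 * n + 1))) :=
      (Finpartition.indiscrete (Finset.singleton_ne_empty 0)).extend hne0 disjoint_compl_right
        sup_compl_eq_top
    have hparts : π.parts = {{0}ᶜ, {0}} := rfl
    have hcard : π.parts.card = 2 := by rw [hparts, Finset.card_pair hne.symm]
    refine ⟨π, ⟨?_, by rw [hcard, hJ.omega3_eq_two hn hAP hQP]⟩, ?_⟩
    · rintro u v w - - - ⟨h1, h2, h3⟩
      -- An external triangle would meet three different classes, but there are only two.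
      have hsub : {π.part u, π.part v, π.part w} ⊆ π.parts := by
        simp only [Finset.insert_subset_iff, Finset.singleton_subset_iff]
        exact ⟨π.part_mem.2 (Finset.mem_univ _), π.part_mem.2 (Finset.mem_univ _),
          π.part_mem.2 (Finset.mem_univ _)⟩
      have := Finset.card_le_card hsub
      rw [Finset.card_eq_three.2 ⟨_, _, _, h1.2, h3.2.symm, h2.2, rfl⟩] at this
      omega
    · unfold numSingularClasses
      rw [hparts, Finset.filter_insert, if_neg (by rw [hc]; omega), Finset.filter_singleton,
        if_pos (Finset.card_singleton _), Finset.card_singleton]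
  · intro π hπ
    have h2 := hJ.card_parts_le_two hAP hQP hπ
    by_contra! h1
    unfold numSingularClasses at h1
    have hle := Finset.card_filter_le π.parts (fun C => C.card = 1)
    have heq : π.parts.filter (fun C => C.card = 1) = π.parts :=
      Finset.eq_of_subset_of_card_le (Finset.filter_subset _ _) (by omega)
    have hsum := π.sum_card_parts
    have hone : ∀ C ∈ π.parts, C.card = 1 := fun C hC => by
      rw [← heq] at hC
      exact (Finset.mem_filter.1 hC).2
    rw [Finset.sum_congr rfl hone, Finset.sum_const, smul_eq_mul, mul_one, Finset.card_univ, hV] at hsum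
    omega
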